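/- Let $n\ge 0$, let $\square=[-1,1]^{n+1}\subset\mathbb{R}^{n+1}$, and let $\Sigma_\square$ be its normal fan, whose cones are the normal cones of the nonempty faces of $\square$. Let $\mathbb{T}\Sigma_\square$ be the tropical toric variety of $\Sigma_\square$, with its stratification into cells indexed by the cones $\rho\in\Sigma_\square$ (the cell of $\rho$ lies in the closure of the cell of $\rho'$ if and only if $\rho'\subseteq\rho$). Let $\mathcal{F}^p$ be the sheaf on this poset of cells given by $\mathcal{F}^p(\rho)=\bigwedge^p\rho^\perp$, where $\rho^\perp\subset\mathbb{Z}^{n+1}$ is the sublattice of integral vectors orthogonal to $\rho$, with the maps $\mathcal{F}^p(\rho)\to\mathcal{F}^p(\rho')$ for $\rho'\subseteq\rho$ induced by $\rho^\perp\subseteq\rho'^\perp$. Let $\cup$ be the cup product on the cohomology of the sheaves $\mathcal{F}^p\otimes\mathbb{F}_2$ induced by the exterior product. Then the map $$Sq:\ H^1(\mathbb{T}\Sigma_\square,\mathcal{F}^1\otimes\mathbb{F}_2)\to H^2(\mathbb{T}\Sigma_\square,\mathcal{F}^2\otimes\mathbb{F}_2),\qquad \beta\mapsto\beta\cup\beta,$$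 is identically zero. Moreover, for any non-zero $D\in H^1(\mathbb{T}\Sigma_\square,\mathcal{F}^1\otimes\mathbb{F}_2)$, the $\mathbb{F}_2$-linear map $$\cup_D:\ H^1(\mathbb{T}\Sigma_\square,\mathcal{F}^1\otimes\mathbb{F}_2)\to H^2(\mathbb{T}\Sigma_\square,\mathcal{F}^2\otimes\mathbb{F}_2),\qquad \beta\mapsto\beta\cup D,$$ has kernel generated by $D$ and rank $n$. -/

import Mathlib

open scoped TensorProduct

noncomputable section

namespace TropicalCube

/-! ### Sheaves on posets, their cohomology and the cup product -/

/-- A sheaf of `k`-modules on a poset `P` (a covariant functor): for a cell complex with face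
poset `P` this is a cellular sheaf, with maps from the faces of a cell to the cell. -/
structure PosetSheaf (k : Type*) [CommRing k] (P : Type*) [PartialOrder P] where
  obj : P → Type
  [addCommGroup : ∀ x, AddCommGroup (obj x)]
  [module : ∀ x, Module k (obj x)]
  map : ∀ {x y : P}, x ≤ y → obj x →ₗ[k] obj y
  map_id : ∀ x : P, map (le_refl x) = LinearMap.id
  map_comp : ∀ {x y z : P} (h : x ≤ y) (h' : y ≤ z), map h' ∘ₗ map h = map (h.trans h')

attribute [instance] PosetSheaf.addCommGroup PosetSheaf.module

section Cohomology

variable {k : Type*} [CommRing k] {P : Type*} [PartialOrder P]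

/-- The `q`-simplices `x₀ < x₁ < ⋯ < x_q` of the order complex of `P`. -/
abbrev Chain (P : Type*) [PartialOrder P] (q : ℕ) : Type _ := Fin (q + 1) ↪o P

/-- The face of a chain that omits its `i`-th element. -/
def Chain.face {q : ℕ} (c : Chain P (q + 1)) (i : Fin (q + 2)) : Chain P q :=
  (Fin.succAboveOrderEmb i).trans c

/-- The front face `x₀ < ⋯ < x_p` of a chain `x₀ < ⋯ < x_{p+q}`. -/
def Chain.front {p q : ℕ} (c : Chain P (p + q)) : Chain P p :=
  (Fin.castLEOrderEmb (by omega : p + 1 ≤ p + q + 1)).trans c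

/-- The back face `x_p < ⋯ < x_{p+q}` of a chain `x₀ < ⋯ < x_{p+q}`. -/
def Chain.back {p q : ℕ} (c : Chain P (p + q)) : Chain P q :=
  (Fin.natAddOrderEmb p : Fin (q + 1) ↪o Fin (p + (q + 1))).trans c

theorem Chain.face_last_le {q : ℕ} (c : Chain P (q + 1)) (i : Fin (q + 2)) :
    c.face i (Fin.last q) ≤ c (Fin.last (q + 1)) :=
  c.monotone (Fin.le_last _)

theorem Chain.front_last_le {p q : ℕ} (c : Chain P (p + q)) :
    (c.front : Chain P p) (Fin.last p) ≤ c (Fin.last (p + q)) :=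
  c.monotone (Fin.le_last _)

theorem Chain.back_last_le {p q : ℕ} (c : Chain P (p + q)) :
    (c.back : Chain P q) (Fin.last q) ≤ c (Fin.last (p + q)) :=
  c.monotone (Fin.le_last _)

/-- Simplicial `q`-cochains on the order complex with values in `F`.  The open simplex
`x₀ < ⋯ < x_q` of the barycentric subdivision lies in the open cell `x_q`. -/
abbrev Cochain (F : PosetSheaf k P) (q : ℕ) : Type _ :=
  ∀ c : Chain P q, F.obj (c (Fin.last q))

/-- The simplicial coboundary. -/
def coboundary (F : PosetSheaf k P) (q : ℕ) : Cochain F q →ₗ[k] Cochain F (q + 1) :=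
  LinearMap.pi fun c => ∑ i : Fin (q + 2),
    (-1 : k) ^ (i : ℕ) •
      (F.map (c.face_last_le i) ∘ₗ LinearMap.proj (c.face i))

/-- The `q`-cocycles. -/
def cocycles (F : PosetSheaf k P) (q : ℕ) : Submodule k (Cochain F q) :=
  LinearMap.ker (coboundary F q)

/-- The `q`-coboundaries. -/
def coboundaries (F : PosetSheaf k P) : (q : ℕ) → Submodule k (Cochain F q)
  | 0 => ⊥
  | q + 1 => LinearMap.range (coboundary F q)

/-- The cohomology `H^q(P; F)`. -/
abbrev Cohomology (F : PosetSheaf k P) (q : ℕ) : Type _ :=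
  cocycles F q ⧸ (coboundaries F q).comap (cocycles F q).subtype

/-- A bilinear pairing of sheaves `F × G → E`, compatible with the sheaf maps. -/
structure Pairing (F G E : PosetSheaf k P) where
  app : ∀ x : P, F.obj x →ₗ[k] G.obj x →ₗ[k] E.obj x
  naturality : ∀ {x y : P} (h : x ≤ y) (a : F.obj x) (b : G.obj x),
    E.map h (app x a b) = app y (F.map h a) (G.map h b)

variable {F G E : PosetSheaf k P}

/-- The (Alexander–Whitney) cup product of cochains:
`(a ∪ b)(x₀ < ⋯ < x_{p+q}) = a(x₀ < ⋯ < x_p)|_{x_{p+q}} · b(x_p < ⋯ < x_{p+q})`. -/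
def cochainCup (μ : Pairing F G E) (p q : ℕ) :
    Cochain F p →ₗ[k] Cochain G q →ₗ[k] Cochain E (p + q) :=
  LinearMap.mk₂ k
    (fun a b c => μ.app (c (Fin.last (p + q)))
      (F.map c.front_last_le (a c.front)) (G.map c.back_last_le (b c.back)))
    (by intro a a' b; funext c; simp only [Pi.add_apply, map_add, LinearMap.add_apply])
    (by intro r a b; funext c; simp only [Pi.smul_apply, map_smul, LinearMap.smul_apply])
    (by intro a b b'; funext c; simp only [Pi.add_apply, map_add])
    (by intro r a b; funext c; simp only [Pi.smul_apply, map_smul])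

theorem PosetSheaf.map_map (F : PosetSheaf k P) {x y z : P} (h : x ≤ y) (h' : y ≤ z)
    (a : F.obj x) : F.map h' (F.map h a) = F.map (h.trans h') a := by
  rw [← F.map_comp h h']; rfl

theorem coboundary_apply (F : PosetSheaf k P) (q : ℕ) (a : Cochain F q) (c : Chain P (q + 1)) :
    coboundary F q a c = ∑ i : Fin (q + 2),
      (-1 : k) ^ (i : ℕ) • F.map (c.face_last_le i) (a (c.face i)) := by
  simp only [coboundary, LinearMap.pi_apply, LinearMap.sum_apply, LinearMap.smul_apply,
    LinearMap.comp_apply, LinearMap.proj_apply]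

theorem coboundary_zero_apply (F : PosetSheaf k P) (s : Cochain F 0) (c : Chain P 1) :
    coboundary F 0 s c =
      F.map (c.face_last_le 0) (s (c.face 0)) - F.map (c.face_last_le 1) (s (c.face 1)) := by
  rw [coboundary_apply, Fin.sum_univ_two]
  simp [sub_eq_add_neg]

theorem cochainCup_apply (μ : Pairing F G E) (p q : ℕ) (a : Cochain F p) (b : Cochain G q)
    (c : Chain P (p + q)) :
    cochainCup μ p q a b c = μ.app (c (Fin.last (p + q)))
      (F.map c.front_last_le (a c.front)) (G.map c.back_last_le (b c.back)) := rfl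

theorem map_congr_chain (F : PosetSheaf k P) {q : ℕ} (a : Cochain F q) {c c' : Chain P q}
    (hc : c = c') {y : P} (h : c (Fin.last q) ≤ y) (h' : c' (Fin.last q) ≤ y) :
    F.map h (a c) = F.map h' (a c') := by
  subst hc; rfl

/-- The restriction to `y` of the cocycle condition for a `1`-cochain. -/
theorem cocycle_one (F : PosetSheaf k P) {a : Cochain F 1} {c : Chain P 2}
    (ha : coboundary F 1 a = 0) {y : P} (h0 : c.face 0 (Fin.last 1) ≤ y)
    (h1 : c.face 1 (Fin.last 1) ≤ y) (h2 : c.face 2 (Fin.last 1) ≤ y)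
    (h : c (Fin.last 2) ≤ y) :
    F.map h1 (a (c.face 1)) = F.map h0 (a (c.face 0)) + F.map h2 (a (c.face 2)) := by
  have e := congrArg (F.map h) (congrFun ha c)
  rw [coboundary_apply, Fin.sum_univ_three] at e
  simp only [map_add, map_smul, F.map_map, Pi.zero_apply, map_zero] at e
  simp at e
  rw [← sub_eq_zero, ← neg_eq_zero, ← e]
  abel

theorem coboundary_cup_eq_zero (μ : Pairing F G E) {a : Cochain F 1} {b : Cochain G 1}
    (ha : coboundary F 1 a = 0) (hb : coboundary G 1 b = 0) :
    coboundary E 2 (cochainCup μ 1 1 a b) = 0 := by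
  funext c
  rw [coboundary_apply, Fin.sum_univ_four]
  simp only [cochainCup_apply, μ.naturality, PosetSheaf.map_map]
  let f : Chain P 2 := Chain.front (p := 2) (q := 1) c
  let g : Chain P 2 := Chain.back (p := 1) (q := 2) c
  have hf : ∀ i, f.face i (Fin.last 1) ≤ c (Fin.last 3) := fun i => c.monotone (Fin.le_last _)
  have hg : ∀ i, g.face i (Fin.last 1) ≤ c (Fin.last 3) := fun i => c.monotone (Fin.le_last _)
  have f0 : Chain.front (p := 1) (q := 1) (c.face 0) = f.face 0 := by
    ext i; fin_cases i <;> rfl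
  have f1 : Chain.front (p := 1) (q := 1) (c.face 1) = f.face 1 := by
    ext i; fin_cases i <;> rfl
  have f2 : Chain.front (p := 1) (q := 1) (c.face 2) = f.face 2 := by
    ext i; fin_cases i <;> rfl
  have f3 : Chain.front (p := 1) (q := 1) (c.face 3) = f.face 2 := by
    ext i; fin_cases i <;> rfl
  have g0 : Chain.back (p := 1) (q := 1) (c.face 0) = g.face 0 := by
    ext i; fin_cases i <;> rfl
  have g1 : Chain.back (p := 1) (q := 1) (c.face 1) = g.face 0 := by
    ext i; fin_cases i <;> rfl
  have g2 : Chain.back (p := 1) (q := 1) (c.face 2) = g.face 1 := by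
    ext i; fin_cases i <;> rfl
  have g3 : Chain.back (p := 1) (q := 1) (c.face 3) = g.face 2 := by
    ext i; fin_cases i <;> rfl
  rw [map_congr_chain F a f0 _ (hf 0), map_congr_chain F a f1 _ (hf 1),
    map_congr_chain F a f2 _ (hf 2), map_congr_chain F a f3 _ (hf 2),
    map_congr_chain G b g0 _ (hg 0), map_congr_chain G b g1 _ (hg 0),
    map_congr_chain G b g2 _ (hg 1), map_congr_chain G b g3 _ (hg 2),
    cocycle_one F ha (hf 0) (hf 1) (hf 2) (c.monotone (Fin.le_last _)),
    cocycle_one G hb (hg 0) (hg 1) (hg 2) (c.monotone (Fin.le_last _))]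
  simp [pow_succ]

theorem coboundary_cup (μ : Pairing F G E) (s : Cochain F 0) {b : Cochain G 1}
    (hb : coboundary G 1 b = 0) :
    cochainCup μ 1 1 (coboundary F 0 s) b = coboundary E 1 (cochainCup μ 0 1 s b) := by
  funext c
  rw [coboundary_apply, Fin.sum_univ_three]
  simp only [cochainCup_apply, μ.naturality, PosetSheaf.map_map, coboundary_zero_apply,
    map_sub]
  have hf : ∀ i j, (c.face i).face j (Fin.last 0) ≤ c (Fin.last 2) :=
    fun i j => c.monotone (Fin.le_last _)
  have hg : ∀ i, c.face i (Fin.last 1) ≤ c (Fin.last 2) := fun i => c.monotone (Fin.le_last _)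
  have f0 : (Chain.front (p := 1) (q := 1) c).face 0 = (c.face 0).face 1 := by
    ext i; fin_cases i; rfl
  have f1 : (Chain.front (p := 1) (q := 1) c).face 1 = (c.face 1).face 1 := by
    ext i; fin_cases i; rfl
  have f2 : Chain.front (p := 0) (q := 1) (c.face 0) = (c.face 0).face 1 := by
    ext i; fin_cases i; rfl
  have f3 : Chain.front (p := 0) (q := 1) (c.face 1) = (c.face 1).face 1 := by
    ext i; fin_cases i; rfl
  have f4 : Chain.front (p := 0) (q := 1) (c.face 2) = (c.face 1).face 1 := by
    ext i; fin_cases i; rfl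
  have g0 : Chain.back (p := 1) (q := 1) c = c.face 0 := by ext i; fin_cases i <;> rfl
  have g1 : Chain.back (p := 0) (q := 1) (c.face 0) = c.face 0 := by ext i; fin_cases i <;> rfl
  have g2 : Chain.back (p := 0) (q := 1) (c.face 1) = c.face 1 := by ext i; fin_cases i <;> rfl
  have g3 : Chain.back (p := 0) (q := 1) (c.face 2) = c.face 2 := by ext i; fin_cases i <;> rfl
  rw [map_congr_chain F s f0 _ (hf 0 1), map_congr_chain F s f1 _ (hf 1 1),
    map_congr_chain F s f2 _ (hf 0 1), map_congr_chain F s f3 _ (hf 1 1),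
    map_congr_chain F s f4 _ (hf 1 1), map_congr_chain G b g0 _ (hg 0),
    map_congr_chain G b g1 _ (hg 0), map_congr_chain G b g2 _ (hg 1),
    map_congr_chain G b g3 _ (hg 2),
    cocycle_one G hb (hg 0) (hg 1) (hg 2) (c.monotone (Fin.le_last _))]
  simp
  abel

theorem cup_coboundary (μ : Pairing F G E) {a : Cochain F 1} (s : Cochain G 0)
    (ha : coboundary F 1 a = 0) :
    cochainCup μ 1 1 a (coboundary G 0 s) = coboundary E 1 (-cochainCup μ 1 0 a s) := by
  funext c
  rw [map_neg, Pi.neg_apply, coboundary_apply, Fin.sum_univ_three]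
  simp only [cochainCup_apply, μ.naturality, PosetSheaf.map_map, coboundary_zero_apply,
    map_sub]
  have hg : ∀ i j, (c.face i).face j (Fin.last 0) ≤ c (Fin.last 2) :=
    fun i j => c.monotone (Fin.le_last _)
  have hf : ∀ i, c.face i (Fin.last 1) ≤ c (Fin.last 2) := fun i => c.monotone (Fin.le_last _)
  have g0 : (Chain.back (p := 1) (q := 1) c).face 0 = (c.face 0).face 0 := by
    ext i; fin_cases i; rfl
  have g1 : (Chain.back (p := 1) (q := 1) c).face 1 = (c.face 2).face 0 := by
    ext i; fin_cases i; rfl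
  have g2 : Chain.back (p := 1) (q := 0) (c.face 0) = (c.face 0).face 0 := by
    ext i; fin_cases i; rfl
  have g3 : Chain.back (p := 1) (q := 0) (c.face 1) = (c.face 0).face 0 := by
    ext i; fin_cases i; rfl
  have g4 : Chain.back (p := 1) (q := 0) (c.face 2) = (c.face 2).face 0 := by
    ext i; fin_cases i; rfl
  have f0 : Chain.front (p := 1) (q := 1) c = c.face 2 := by ext i; fin_cases i <;> rfl
  have f1 : Chain.front (p := 1) (q := 0) (c.face 0) = c.face 0 := by ext i; fin_cases i <;> rfl
  have f2 : Chain.front (p := 1) (q := 0) (c.face 1) = c.face 1 := by ext i; fin_cases i <;> rfl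
  have f3 : Chain.front (p := 1) (q := 0) (c.face 2) = c.face 2 := by ext i; fin_cases i <;> rfl
  rw [map_congr_chain G s g0 _ (hg 0 0), map_congr_chain G s g1 _ (hg 2 0),
    map_congr_chain G s g2 _ (hg 0 0), map_congr_chain G s g3 _ (hg 0 0),
    map_congr_chain G s g4 _ (hg 2 0), map_congr_chain F a f0 _ (hf 2),
    map_congr_chain F a f1 _ (hf 0), map_congr_chain F a f2 _ (hf 1),
    map_congr_chain F a f3 _ (hf 2),
    cocycle_one F ha (hf 0) (hf 1) (hf 2) (c.monotone (Fin.le_last _))]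
  simp
  abel

/-- The cup product of cocycles, as a map to cohomology. -/
def cocycleCup (μ : Pairing F G E) :
    cocycles F 1 →ₗ[k] cocycles G 1 →ₗ[k] Cohomology E 2 :=
  LinearMap.mk₂ k
    (fun a b => Submodule.Quotient.mk
      ⟨cochainCup μ 1 1 a.1 b.1, coboundary_cup_eq_zero μ a.2 b.2⟩)
    (by
      intro a a' b
      rw [← Submodule.Quotient.mk_add]
      congr 1; ext1; simp)
    (by
      intro r a b
      rw [← Submodule.Quotient.mk_smul]
      congr 1; ext1; simp)
    (by
      intro a b b'
      rw [← Submodule.Quotient.mk_add]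
      congr 1; ext1; simp)
    (by
      intro r a b
      rw [← Submodule.Quotient.mk_smul]
      congr 1; ext1; simp)

/-- The cup product `H¹(P; F) × H¹(P; G) → H²(P; E)` induced by a pairing `F × G → E`. -/
def cup (μ : Pairing F G E) : Cohomology F 1 →ₗ[k] Cohomology G 1 →ₗ[k] Cohomology E 2 :=
  Submodule.liftQ _
    (LinearMap.flip (Submodule.liftQ _ (cocycleCup μ).flip (by
      rintro ⟨b, hb⟩ ⟨s, rfl⟩
      ext a
      refine (Submodule.Quotient.mk_eq_zero _).2 ⟨-cochainCup μ 1 0 a.1 s, ?_⟩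
      exact (cup_coboundary μ s a.2).symm)))
    (by
      rintro ⟨a, ha⟩ ⟨s, rfl⟩
      ext b
      refine (Submodule.Quotient.mk_eq_zero _).2 ⟨cochainCup μ 0 1 s b.1, ?_⟩
      exact (coboundary_cup μ s b.2).symm)

/-- On representing cocycles, `cup` is the cochain cup product. -/
theorem cup_mk (μ : Pairing F G E) (a : cocycles F 1) (b : cocycles G 1) :
    cup μ (Submodule.Quotient.mk a) (Submodule.Quotient.mk b) =
      Submodule.Quotient.mk
        ⟨cochainCup μ 1 1 a.1 b.1, coboundary_cup_eq_zero μ a.2 b.2⟩ := rfl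

end Cohomology

/-! ### Normal fans and tropical toric varieties -/

section Fan

variable {d : ℕ}

/-- The cone of (outer) normal vectors to the polytope `Δ` along its face `A`. -/
def normalCone (Δ A : Set (Fin d → ℝ)) : PointedCone ℝ (Fin d → ℝ) where
  carrier := {v | ∀ u ∈ A, ∀ w ∈ Δ, w ⬝ᵥ v ≤ u ⬝ᵥ v}
  add_mem' := by
    intro v v' hv hv' u hu w hw
    rw [dotProduct_add, dotProduct_add]
    exact add_le_add (hv u hu w hw) (hv' u hu w hw)
  zero_mem' := by intro u _ w _; simp
  smul_mem' := by
    intro r v hv u hu w hw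
    have h := mul_le_mul_of_nonneg_left (hv u hu w hw) r.2
    rw [Nonneg.mk_smul, dotProduct_smul, dotProduct_smul]
    exact h

/-- The normal fan `Σ_Δ` of a polytope `Δ`: the normal cones to its nonempty faces. -/
def normalFan (Δ : Set (Fin d → ℝ)) : Set (PointedCone ℝ (Fin d → ℝ)) :=
  {ρ | ∃ A : Set (Fin d → ℝ), A.Nonempty ∧ IsExposed ℝ Δ A ∧ ρ = normalCone Δ A}

/-- The face poset of the tropical toric variety `𝕋Σ` of a fan `Σ`: the cell of a cone `ρ`
is `N_ℝ / ⟨ρ⟩`, and it lies in the closure of the cell of `ρ'` iff `ρ' ⊆ ρ`, so the order is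
the inverse of inclusion. -/
abbrev CellPoset (S : Set (PointedCone ℝ (Fin d → ℝ))) : Type := (S)ᵒᵈ

/-- The cone of a cell. -/
def CellPoset.cone {S : Set (PointedCone ℝ (Fin d → ℝ))} (x : CellPoset S) :
    PointedCone ℝ (Fin d → ℝ) := (OrderDual.ofDual x).1

/-- The sublattice `ρ^⊥` of `ℤ^d` orthogonal to the cone `ρ`. -/
def perp (ρ : PointedCone ℝ (Fin d → ℝ)) : Submodule ℤ (Fin d → ℤ) where
  carrier := {m | ∀ v ∈ ρ, (fun i => (m i : ℝ)) ⬝ᵥ v = 0}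
  add_mem' := by
    intro m m' hm hm' v hv
    have h := hm v hv
    have h' := hm' v hv
    simp only [dotProduct, Pi.add_apply, Int.cast_add, add_mul, Finset.sum_add_distrib] at *
    rw [h, h', add_zero]
  zero_mem' := by intro v _; simp [dotProduct]
  smul_mem' := by
    intro r m hm v hv
    have h := hm v hv
    simp only [dotProduct, Pi.smul_apply, smul_eq_mul, Int.cast_mul, mul_assoc,
      ← Finset.mul_sum] at *
    rw [h, mul_zero]

theorem perp_anti {ρ ρ' : PointedCone ℝ (Fin d → ℝ)} (h : ρ' ≤ ρ) : perp ρ ≤ perp ρ' :=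
  fun _ hm v hv => hm v (h hv)

/-- The map `𝔽₂ ⊗ ⋀^p L → 𝔽₂ ⊗ ⋀^p L'` induced by an inclusion of lattices `L ⊆ L'`. -/
def inclusionMap (p : ℕ) {L L' : Submodule ℤ (Fin d → ℤ)} (h : L ≤ L') :
    ZMod 2 ⊗[ℤ] ⋀[ℤ]^p L →ₗ[ZMod 2] ZMod 2 ⊗[ℤ] ⋀[ℤ]^p L' :=
  (exteriorPower.map p (Submodule.inclusion h)).baseChange (ZMod 2)

theorem inclusionMap_id (p : ℕ) (L : Submodule ℤ (Fin d → ℤ)) :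
    inclusionMap p (le_refl L) = LinearMap.id := by
  have h : Submodule.inclusion (le_refl L) = LinearMap.id := rfl
  rw [inclusionMap, h, exteriorPower.map_id, LinearMap.baseChange_id]

theorem inclusionMap_comp (p : ℕ) {L L' L'' : Submodule ℤ (Fin d → ℤ)} (h : L ≤ L')
    (h' : L' ≤ L'') : inclusionMap p h' ∘ₗ inclusionMap p h = inclusionMap p (h.trans h') := by
  rw [inclusionMap, inclusionMap, ← LinearMap.baseChange_comp, ← exteriorPower.map_comp]
  rfl

/-- The sheaf `𝓕^p ⊗ 𝔽₂` on `𝕋Σ`, with `𝓕^p(ρ) = ⋀^p ρ^⊥` and the sheaf maps induced by the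
inclusions `ρ^⊥ ⊆ ρ'^⊥` for `ρ' ⊆ ρ`. -/
def multitangentSheaf (S : Set (PointedCone ℝ (Fin d → ℝ))) (p : ℕ) :
    PosetSheaf (ZMod 2) (CellPoset S) where
  obj x := ZMod 2 ⊗[ℤ] ⋀[ℤ]^p (perp x.cone)
  map {x y} h := inclusionMap p (perp_anti (show y.cone ≤ x.cone from h))
  map_id x := inclusionMap_id p (perp x.cone)
  map_comp _ _ := inclusionMap_comp p _ _

/-- The exterior product `⋀^p L × ⋀^q L → ⋀^{p+q} L`. -/
def wedge (L : Type*) [AddCommGroup L] (p q : ℕ) :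
    ⋀[ℤ]^p L →ₗ[ℤ] ⋀[ℤ]^q L →ₗ[ℤ] ⋀[ℤ]^(p + q) L :=
  LinearMap.mk₂ ℤ (fun a b => ⟨a.1 * b.1, SetLike.mul_mem_graded a.2 b.2⟩)
    (by intro a a' b; ext1; simp [add_mul])
    (by intro r a b; ext1; simp [mul_assoc])
    (by intro a b b'; ext1; simp [mul_add])
    (by intro r a b; ext1; exact mul_smul_comm r a.1 b.1)

/-- The exterior product modulo `2`: `(s ⊗ a) ∧ (t ⊗ b) = s t ⊗ (a ∧ b)`. -/
def wedgeModTwo (L : Type*) [AddCommGroup L] (p q : ℕ) :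
    ZMod 2 ⊗[ℤ] ⋀[ℤ]^p L →ₗ[ZMod 2] ZMod 2 ⊗[ℤ] ⋀[ℤ]^q L →ₗ[ZMod 2]
      ZMod 2 ⊗[ℤ] ⋀[ℤ]^(p + q) L :=
  LinearMap.liftBaseChange (ZMod 2)
    (LinearMap.baseChangeHom ℤ (ZMod 2) (⋀[ℤ]^q L) (⋀[ℤ]^(p + q) L) ∘ₗ wedge L p q)

theorem wedgeModTwo_tmul (L : Type*) [AddCommGroup L] (p q : ℕ) (s t : ZMod 2)
    (a : ⋀[ℤ]^p L) (b : ⋀[ℤ]^q L) :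
    wedgeModTwo L p q (s ⊗ₜ a) (t ⊗ₜ b) = (s * t) ⊗ₜ wedge L p q a b := by
  simp [wedgeModTwo, TensorProduct.smul_tmul']

theorem coe_exteriorPower_map {L L' : Type*} [AddCommGroup L] [AddCommGroup L'] (p : ℕ)
    (f : L →ₗ[ℤ] L') (a : ⋀[ℤ]^p L) :
    (exteriorPower.map p f a : ExteriorAlgebra ℤ L') = ExteriorAlgebra.map f a.1 := by
  have h : (⋀[ℤ]^p L').subtype ∘ₗ exteriorPower.map p f =
      (ExteriorAlgebra.map f).toLinearMap ∘ₗ (⋀[ℤ]^p L).subtype := by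
    apply exteriorPower.linearMap_ext
    ext m
    simp [ExteriorAlgebra.map_apply_ιMulti]
  exact LinearMap.congr_fun h a

theorem wedge_map (p q : ℕ) {L L' : Submodule ℤ (Fin d → ℤ)} (h : L ≤ L')
    (a : ⋀[ℤ]^p L) (b : ⋀[ℤ]^q L) :
    exteriorPower.map (p + q) (Submodule.inclusion h) (wedge L p q a b) =
      wedge L' p q (exteriorPower.map p (Submodule.inclusion h) a)
        (exteriorPower.map q (Submodule.inclusion h) b) := by
  apply Subtype.ext
  have e := map_mul (ExteriorAlgebra.map (Submodule.inclusion h)) a.1 b.1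
  rw [← coe_exteriorPower_map, ← coe_exteriorPower_map] at e
  rw [coe_exteriorPower_map]
  exact e

theorem wedgeModTwo_inclusionMap (p q : ℕ) {L L' : Submodule ℤ (Fin d → ℤ)} (h : L ≤ L')
    (a : ZMod 2 ⊗[ℤ] ⋀[ℤ]^p L) (b : ZMod 2 ⊗[ℤ] ⋀[ℤ]^q L) :
    inclusionMap (p + q) h (wedgeModTwo L p q a b) =
      wedgeModTwo L' p q (inclusionMap p h a) (inclusionMap q h b) := by
  induction a using TensorProduct.induction_on with
  | zero => simp
  | add a a' ha ha' => simp only [map_add, LinearMap.add_apply, ha, ha']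
  | tmul s a =>
    induction b using TensorProduct.induction_on with
    | zero => simp
    | add b b' hb hb' => simp only [map_add, hb, hb']
    | tmul t b =>
      simp only [inclusionMap, wedgeModTwo_tmul, LinearMap.baseChange_tmul, wedge_map]

/-- The pairing `(𝓕^p ⊗ 𝔽₂) × (𝓕^q ⊗ 𝔽₂) → 𝓕^{p+q} ⊗ 𝔽₂` given by the exterior product. -/
def wedgePairing (S : Set (PointedCone ℝ (Fin d → ℝ))) (p q : ℕ) :
    Pairing (multitangentSheaf S p) (multitangentSheaf S q) (multitangentSheaf S (p + q)) where
  app x := wedgeModTwo (perp x.cone) p q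
  naturality _ a b := wedgeModTwo_inclusionMap p q _ a b

/-- `H^q(𝕋Σ, 𝓕^p ⊗ 𝔽₂)`. -/
abbrev tropicalCohomology (S : Set (PointedCone ℝ (Fin d → ℝ))) (q p : ℕ) : Type _ :=
  Cohomology (multitangentSheaf S p) q

/-- The cup product
`H¹(𝕋Σ, 𝓕¹ ⊗ 𝔽₂) × H¹(𝕋Σ, 𝓕¹ ⊗ 𝔽₂) → H²(𝕋Σ, 𝓕² ⊗ 𝔽₂)`. -/
def tropicalCup (S : Set (PointedCone ℝ (Fin d → ℝ))) :
    tropicalCohomology S 1 1 →ₗ[ZMod 2] tropicalCohomology S 1 1 →ₗ[ZMod 2]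
      tropicalCohomology S 2 2 :=
  cup (wedgePairing S 1 1)

/-- The cube `□ = [-1,1]^d`. -/
def cube (d : ℕ) : Set (Fin d → ℝ) := Set.Icc (-1) 1

/-- The normal fan `Σ_□` of the cube. -/
def cubeFan (d : ℕ) : Set (PointedCone ℝ (Fin d → ℝ)) := normalFan (cube d)

end Fan

end TropicalCube

end

/-!
Since the face poset has a greatest element, the open cell, constant sheaves on it are acyclic, so
in the coordinates of `ℤ^d` a `1`-cocycle with values in `𝓕¹ ⊗ 𝔽₂` is the coboundary of a potential
with values in `𝔽₂^d`. The `i`-th coordinate of the potential is constant on the closed strata of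
`± eᵢ`, where the `i`-th coordinate of `𝓕¹` vanishes; the sum of these two constants is the `i`-th
period, and the periods identify `H¹` with `𝔽₂^d`.

All the lattices `ρ^⊥` are spanned by standard basis vectors. The exterior product modulo `2` is
therefore the symmetrization of the natural bilinear form `∑_{i < j} aᵢ bⱼ eᵢ ∧ eⱼ`, and for such a
product every `β ∪ β` is a coboundary.

Summing the `eᵢ ∧ eⱼ`-coefficients over the flags of cells in the `ij`-plane gives a functional on
`H²` whose value on `β ∪ D` is the minor `pᵢ(β) pⱼ(D) - pⱼ(β) pᵢ(D)` of the periods. So `β ∪ D = 0`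
only if the period vectors of `β` and `D` are proportional.
-/

noncomputable section

namespace TropicalCube

section ModTwo

variable {L : Type*} [AddCommGroup L]

/-- The reduction modulo `2` of an element of an abelian group, as an element of the first
exterior power. -/
def degreeOne (L : Type*) [AddCommGroup L] : L →+ ZMod 2 ⊗[ℤ] ⋀[ℤ]^1 L :=
  (TensorProduct.mk ℤ (ZMod 2) (⋀[ℤ]^1 L) 1).toAddMonoidHom.comp
    (exteriorPower.oneEquiv ℤ L).symm.toLinearMap.toAddMonoidHom

theorem degreeOne_apply (m : L) : degreeOne L m = 1 ⊗ₜ (exteriorPower.oneEquiv ℤ L).symm m := rfl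

theorem degreeOne_surjective : Function.Surjective (degreeOne L) :=
  (TensorProduct.mk_surjective ℤ (⋀[ℤ]^1 L) (ZMod 2) (ZMod.ringHom_surjective _)).comp
    (exteriorPower.oneEquiv ℤ L).symm.surjective

theorem wedgeModTwo_degreeOne (m m' : L) :
    wedgeModTwo L 1 1 (degreeOne L m) (degreeOne L m') =
      1 ⊗ₜ exteriorPower.ιMulti ℤ (1 + 1) ![m, m'] := by
  have symm_eq (m : L) :
      (exteriorPower.oneEquiv ℤ L).symm m = exteriorPower.ιMulti ℤ 1 fun _ => m := by
    rw [LinearEquiv.symm_apply_eq, exteriorPower.oneEquiv_ιMulti]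
  rw [degreeOne_apply, degreeOne_apply, wedgeModTwo_tmul, one_mul]
  refine congrArg _ (Subtype.ext ?_)
  simp [symm_eq, wedge, ExteriorAlgebra.ιMulti_apply]

theorem wedgeModTwo_isAlt : (wedgeModTwo L 1 1).IsAlt := fun a => by
  obtain ⟨m, rfl⟩ := degreeOne_surjective a
  rw [wedgeModTwo_degreeOne, (exteriorPower.ιMulti ℤ (1 + 1)).map_eq_zero_of_eq ![m, m]
    (i := 0) (j := 1) rfl zero_ne_one, TensorProduct.tmul_zero]

theorem wedgeModTwo_comm (a b : ZMod 2 ⊗[ℤ] ⋀[ℤ]^1 L) :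
    wedgeModTwo L 1 1 a b = wedgeModTwo L 1 1 b a := by
  rw [← wedgeModTwo_isAlt.neg, ZModModule.neg_eq_self]

theorem exteriorSquare_hom_ext {M : Type*} [AddCommGroup M] [Module (ZMod 2) M]
    {f g : ZMod 2 ⊗[ℤ] ⋀[ℤ]^(1 + 1) L →ₗ[ZMod 2] M}
    (h : ∀ a b, f (wedgeModTwo L 1 1 a b) = g (wedgeModTwo L 1 1 a b)) : f = g := by
  ext m
  have hm : m = ![m 0, m 1] := by ext i; fin_cases i <;> rfl
  have key := h (degreeOne L (m 0)) (degreeOne L (m 1))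
  rw [wedgeModTwo_degreeOne, ← hm] at key
  simpa using key

/-- The functional on the first exterior power modulo `2` induced by an integral functional. -/
def dualModTwo (f : Module.Dual ℤ L) : ZMod 2 ⊗[ℤ] ⋀[ℤ]^1 L →ₗ[ZMod 2] ZMod 2 :=
  LinearMap.liftBaseChange (ZMod 2)
    (Algebra.linearMap ℤ (ZMod 2) ∘ₗ f ∘ₗ (exteriorPower.oneEquiv ℤ L).toLinearMap)

@[simp]
theorem dualModTwo_degreeOne (f : Module.Dual ℤ L) (m : L) :
    dualModTwo f (degreeOne L m) = f m := by
  simp [dualModTwo, degreeOne_apply]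

/-- The functional `a ∧ b ↦ f(a) g(b) - f(b) g(a)` on the second exterior power modulo `2`. -/
def minorModTwo (f g : Module.Dual ℤ L) : ZMod 2 ⊗[ℤ] ⋀[ℤ]^(1 + 1) L →ₗ[ZMod 2] ZMod 2 :=
  LinearMap.liftBaseChange (ZMod 2)
    (Algebra.linearMap ℤ (ZMod 2) ∘ₗ exteriorPower.alternatingMapToDual ℤ L (1 + 1) ![f, g])

theorem minorModTwo_wedge (f g : Module.Dual ℤ L) (a b : ZMod 2 ⊗[ℤ] ⋀[ℤ]^1 L) :
    minorModTwo f g (wedgeModTwo L 1 1 a b) =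
      dualModTwo f a * dualModTwo g b - dualModTwo f b * dualModTwo g a := by
  obtain ⟨m, rfl⟩ := degreeOne_surjective a
  obtain ⟨m', rfl⟩ := degreeOne_surjective b
  rw [wedgeModTwo_degreeOne, minorModTwo, LinearMap.liftBaseChange_tmul, LinearMap.comp_apply,
    exteriorPower.alternatingMapToDual_apply_ιMulti, Matrix.det_fin_two]
  simp [mul_comm]

theorem minorModTwo_comm (f g : Module.Dual ℤ L) : minorModTwo f g = minorModTwo g f := by
  refine exteriorSquare_hom_ext fun a b => ?_
  rw [minorModTwo_wedge, minorModTwo_wedge, ← neg_sub, ZModModule.neg_eq_self]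
  ring

@[simp]
theorem minorModTwo_zero_left (g : Module.Dual ℤ L) : minorModTwo 0 g = 0 := by
  rw [minorModTwo, AlternatingMap.map_coord_zero _ (0 : Fin 2) rfl]
  simp

end ModTwo

section CoordinateLattice

variable {d : ℕ} {L L' : Submodule ℤ (Fin d → ℤ)}

theorem inclusionMap_degreeOne (h : L ≤ L') (m : L) :
    inclusionMap 1 h (degreeOne L m) = degreeOne L' (Submodule.inclusion h m) := by
  have naturality := LinearMap.congr_fun
    (exteriorPower.oneEquiv_naturality (Submodule.inclusion h))
    ((exteriorPower.oneEquiv ℤ L).symm m)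
  rw [degreeOne_apply, degreeOne_apply, inclusionMap, LinearMap.baseChange_tmul]
  congr 1
  rw [LinearEquiv.eq_symm_apply]
  simpa using naturality

theorem dualModTwo_inclusionMap (f : Module.Dual ℤ (Fin d → ℤ)) (h : L ≤ L')
    (a : ZMod 2 ⊗[ℤ] ⋀[ℤ]^1 L) :
    dualModTwo (f ∘ₗ L'.subtype) (inclusionMap 1 h a) = dualModTwo (f ∘ₗ L.subtype) a := by
  obtain ⟨m, rfl⟩ := degreeOne_surjective a
  simp [inclusionMap_degreeOne]

theorem minorModTwo_inclusionMap (f g : Module.Dual ℤ (Fin d → ℤ)) (h : L ≤ L')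
    (w : ZMod 2 ⊗[ℤ] ⋀[ℤ]^(1 + 1) L) :
    minorModTwo (f ∘ₗ L'.subtype) (g ∘ₗ L'.subtype) (inclusionMap (1 + 1) h w) =
      minorModTwo (f ∘ₗ L.subtype) (g ∘ₗ L.subtype) w := by
  refine LinearMap.congr_fun (f := minorModTwo _ _ ∘ₗ inclusionMap (1 + 1) h)
    (exteriorSquare_hom_ext fun a b => ?_) w
  rw [LinearMap.comp_apply, wedgeModTwo_inclusionMap]
  simp only [minorModTwo_wedge, dualModTwo_inclusionMap]

/-- A sublattice of `ℤ^d` spanned by some of the standard basis vectors. -/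
def IsCoordinate (L : Submodule ℤ (Fin d → ℤ)) : Prop :=
  ∀ m ∈ L, ∀ i, m i ≠ 0 → Pi.single i 1 ∈ L

/-- The `i`-th coordinate functional on a sublattice of `ℤ^d`. -/
def coordForm (L : Submodule ℤ (Fin d → ℤ)) (i : Fin d) : Module.Dual ℤ L :=
  LinearMap.proj i ∘ₗ L.subtype

theorem coordForm_eq_zero (hL : IsCoordinate L) {i : Fin d} (hi : Pi.single i 1 ∉ L) :
    coordForm L i = 0 :=
  LinearMap.ext fun m => not_imp_comm.1 (hL m m.2 i) hi

/-- The coordinates modulo `2`, on the first exterior power of a sublattice of `ℤ^d`. -/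
def coord (L : Submodule ℤ (Fin d → ℤ)) : ZMod 2 ⊗[ℤ] ⋀[ℤ]^1 L →ₗ[ZMod 2] (Fin d → ZMod 2) :=
  LinearMap.pi fun i => dualModTwo (coordForm L i)

theorem coord_apply (a : ZMod 2 ⊗[ℤ] ⋀[ℤ]^1 L) (i : Fin d) :
    coord L a i = dualModTwo (coordForm L i) a := rfl

theorem coord_degreeOne (m : L) (i : Fin d) : coord L (degreeOne L m) i = m.1 i :=
  dualModTwo_degreeOne _ m

theorem coord_inclusionMap (h : L ≤ L') (a : ZMod 2 ⊗[ℤ] ⋀[ℤ]^1 L) :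
    coord L' (inclusionMap 1 h a) = coord L a :=
  funext fun i => dualModTwo_inclusionMap (LinearMap.proj i) h a

theorem coord_eq_zero (hL : IsCoordinate L) {i : Fin d} (hi : Pi.single i 1 ∉ L)
    (a : ZMod 2 ⊗[ℤ] ⋀[ℤ]^1 L) : coord L a i = 0 := by
  obtain ⟨m, rfl⟩ := degreeOne_surjective a
  simp [coord_apply, coordForm_eq_zero hL hi]

open Classical in
/-- The `i`-th standard basis vector if it lies in `L`, and zero otherwise. -/
def basisVec (L : Submodule ℤ (Fin d → ℤ)) (i : Fin d) : L :=
  if h : Pi.single i 1 ∈ L then ⟨Pi.single i 1, h⟩ else 0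

theorem basisVec_of_mem {i : Fin d} (h : Pi.single i 1 ∈ L) :
    basisVec L i = ⟨Pi.single i 1, h⟩ :=
  dif_pos h

theorem sum_smul_basisVec (hL : IsCoordinate L) (m : L) : ∑ i, m.1 i • basisVec L i = m := by
  have coe_smul (i : Fin d) :
      ((m.1 i • basisVec L i : L) : Fin d → ℤ) = Pi.single i (m.1 i) := by
    by_cases hi : m.1 i = 0
    · simp [hi]
    · simp [basisVec_of_mem (hL m m.2 i hi), ← Pi.single_smul]
  apply Subtype.ext
  rw [AddSubmonoidClass.coe_finsetSum]
  simp only [coe_smul, Finset.univ_sum_single]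

/-- The `i`-th component of an element of the first exterior power modulo `2`. -/
def component (L : Submodule ℤ (Fin d → ℤ)) (i : Fin d) :
    ZMod 2 ⊗[ℤ] ⋀[ℤ]^1 L →ₗ[ZMod 2] ZMod 2 ⊗[ℤ] ⋀[ℤ]^1 L :=
  (dualModTwo (coordForm L i)).smulRight (degreeOne L (basisVec L i))

theorem component_apply (i : Fin d) (a : ZMod 2 ⊗[ℤ] ⋀[ℤ]^1 L) :
    component L i a = coord L a i • degreeOne L (basisVec L i) := rfl

theorem sum_component (hL : IsCoordinate L) (a : ZMod 2 ⊗[ℤ] ⋀[ℤ]^1 L) :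
    ∑ i, component L i a = a := by
  obtain ⟨m, rfl⟩ := degreeOne_surjective a
  simp only [component_apply, coord_degreeOne, Int.cast_smul_eq_zsmul, ← map_zsmul, ← map_sum,
    sum_smul_basisVec hL]

theorem inclusionMap_component (hL : IsCoordinate L) (h : L ≤ L') (i : Fin d)
    (a : ZMod 2 ⊗[ℤ] ⋀[ℤ]^1 L) :
    inclusionMap 1 h (component L i a) = component L' i (inclusionMap 1 h a) := by
  rw [component_apply, component_apply, map_smul, coord_inclusionMap]
  by_cases hi : Pi.single i 1 ∈ L
  · rw [inclusionMap_degreeOne, basisVec_of_mem hi, basisVec_of_mem (h hi)]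
    rfl
  · rw [coord_eq_zero hL hi, zero_smul, zero_smul]

theorem coord_injective (hL : IsCoordinate L) : Function.Injective (coord L) := fun a b h => by
  rw [← sum_component hL a, ← sum_component hL b]
  simp only [component_apply, h]

theorem mem_range_coord (hL : IsCoordinate L) {t : Fin d → ZMod 2} :
    t ∈ LinearMap.range (coord L) ↔ ∀ i, Pi.single i 1 ∉ L → t i = 0 := by
  constructor
  · rintro ⟨a, rfl⟩ i hi
    exact coord_eq_zero hL hi a
  · intro ht
    have smul_coord (i : Fin d) :
        t i • coord L (degreeOne L (basisVec L i)) = Pi.single i (t i) := by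
      by_cases hi : Pi.single i 1 ∈ L
      · ext j
        simp [coord_degreeOne, basisVec_of_mem hi, Pi.single_apply]
      · simp [ht i hi]
    refine ⟨∑ i, t i • degreeOne L (basisVec L i), ?_⟩
    simp only [map_sum, map_smul, smul_coord, Finset.univ_sum_single]

/-- The bilinear form `∑_{i < j} aᵢ bⱼ eᵢ ∧ eⱼ`, of which the exterior product is the
symmetrization. -/
def triangularWedge (L : Submodule ℤ (Fin d → ℤ)) :
    ZMod 2 ⊗[ℤ] ⋀[ℤ]^1 L →ₗ[ZMod 2] ZMod 2 ⊗[ℤ] ⋀[ℤ]^1 L →ₗ[ZMod 2]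
      ZMod 2 ⊗[ℤ] ⋀[ℤ]^(1 + 1) L :=
  ∑ i, ∑ j ∈ Finset.Ioi i, (wedgeModTwo L 1 1).compl₁₂ (component L i) (component L j)

theorem triangularWedge_apply (a b : ZMod 2 ⊗[ℤ] ⋀[ℤ]^1 L) :
    triangularWedge L a b =
      ∑ i, ∑ j ∈ Finset.Ioi i, wedgeModTwo L 1 1 (component L i a) (component L j b) := by
  simp [triangularWedge, LinearMap.sum_apply]

theorem inclusionMap_triangularWedge (hL : IsCoordinate L) (h : L ≤ L')
    (a b : ZMod 2 ⊗[ℤ] ⋀[ℤ]^1 L) :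
    inclusionMap (1 + 1) h (triangularWedge L a b) =
      triangularWedge L' (inclusionMap 1 h a) (inclusionMap 1 h b) := by
  simp only [triangularWedge_apply, map_sum, wedgeModTwo_inclusionMap,
    inclusionMap_component hL]

theorem wedgeModTwo_component_self (i : Fin d) (a b : ZMod 2 ⊗[ℤ] ⋀[ℤ]^1 L) :
    wedgeModTwo L 1 1 (component L i a) (component L i b) = 0 := by
  simp only [component_apply, map_smul, LinearMap.smul_apply, wedgeModTwo_isAlt _, smul_zero]

theorem wedgeModTwo_eq_triangularWedge_add (hL : IsCoordinate L) (a b : ZMod 2 ⊗[ℤ] ⋀[ℤ]^1 L) :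
    wedgeModTwo L 1 1 a b = triangularWedge L a b + triangularWedge L b a := by
  have offDiag (i : Fin d) :
      ∑ j, wedgeModTwo L 1 1 (component L j a) (component L i b) =
        ∑ j ∈ {i}ᶜ, wedgeModTwo L 1 1 (component L j a) (component L i b) := by
    rw [Fintype.sum_eq_add_sum_compl i, wedgeModTwo_component_self, zero_add]
  calc wedgeModTwo L 1 1 a b
      = ∑ i, ∑ j, wedgeModTwo L 1 1 (component L j a) (component L i b) := by
        conv_lhs => rw [← sum_component hL a, ← sum_component hL b]
        simp only [map_sum, LinearMap.sum_apply]
    _ = ∑ i, ∑ j ∈ Finset.Ioi i, (wedgeModTwo L 1 1 (component L j a) (component L i b) +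
          wedgeModTwo L 1 1 (component L i a) (component L j b)) := by
        simp only [offDiag]
        exact (Finset.sum_sum_Ioi_add_eq_sum_sum_off_diag fun j i =>
          wedgeModTwo L 1 1 (component L j a) (component L i b)).symm
    _ = triangularWedge L a b + triangularWedge L b a := by
        simp only [triangularWedge_apply, Finset.sum_add_distrib,
          wedgeModTwo_comm (component L _ a)]
        exact add_comm _ _

end CoordinateLattice

section Cochains

variable {k : Type*} [CommRing k] {P : Type*} [PartialOrder P]

theorem cochainCup_self_of_app_eq_add_swap {F E : PosetSheaf k P} {μ ν : Pairing F F E}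
    (h : ∀ x a b, μ.app x a b = ν.app x a b + ν.app x b a) {a : Cochain F 1}
    (ha : coboundary F 1 a = 0) :
    cochainCup μ 1 1 a a =
      coboundary E 1 (-fun c : Chain P 1 => ν.app (c (Fin.last 1)) (a c) (a c)) := by
  funext c
  have front_eq : Chain.front (p := 1) (q := 1) c = c.face 2 := by ext i; fin_cases i <;> rfl
  have back_eq : Chain.back (p := 1) (q := 1) c = c.face 0 := by ext i; fin_cases i <;> rfl
  rw [cochainCup_apply, h, map_congr_chain F a front_eq _ (c.face_last_le 2),
    map_congr_chain F a back_eq _ (c.face_last_le 0), coboundary_apply, Fin.sum_univ_three]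
  simp only [Pi.neg_apply, map_neg, ν.naturality,
    cocycle_one F ha (c.face_last_le 0) (c.face_last_le 1) (c.face_last_le 2) le_rfl,
    map_add, LinearMap.add_apply, Fin.val_zero, Fin.val_one, Fin.val_two, pow_zero, pow_one,
    neg_one_sq, one_smul, neg_smul]
  abel

theorem cup_self_of_app_eq_add_swap {F E : PosetSheaf k P} {μ ν : Pairing F F E}
    (h : ∀ x a b, μ.app x a b = ν.app x a b + ν.app x b a) (β : Cohomology F 1) :
    cup μ β β = 0 := by
  obtain ⟨a, rfl⟩ := Submodule.Quotient.mk_surjective _ β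
  rw [cup_mk]
  exact (Submodule.Quotient.mk_eq_zero _).2
    ⟨_, (cochainCup_self_of_app_eq_add_swap h a.2).symm⟩

/-- The map on cohomology induced by a linear map on cochains that vanishes on coboundaries. -/
def cohomologyLift {F : PosetSheaf k P} {M : Type*} [AddCommGroup M] [Module k M] {q : ℕ}
    (f : Cochain F (q + 1) →ₗ[k] M) (hf : ∀ a, f (coboundary F q a) = 0) :
    Cohomology F (q + 1) →ₗ[k] M :=
  Submodule.liftQ _ (f ∘ₗ (cocycles F (q + 1)).subtype) (by
    rintro ⟨c, hc⟩ ⟨a, rfl⟩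
    exact hf a)

/-- The chain consisting of `x`. -/
def pointChain (x : P) : Chain P 0 :=
  OrderEmbedding.ofStrictMono (fun _ => x) (Subsingleton.strictMono (α := Fin 1) _)

/-- The chain `x < y`. -/
def pairChain {x y : P} (h : x < y) : Chain P 1 :=
  OrderEmbedding.ofStrictMono ![x, y] (Fin.strictMono_iff_lt_succ.2 fun i => by
    fin_cases i; exact h)

/-- The chain `x < y < z`. -/
def tripleChain {x y z : P} (h : x < y) (h' : y < z) : Chain P 2 :=
  OrderEmbedding.ofStrictMono ![x, y, z] (Fin.strictMono_iff_lt_succ.2 fun i => by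
    fin_cases i
    · exact h
    · exact h')

theorem eq_pairChain (c : Chain P 1) : c = pairChain (c.strictMono Fin.zero_lt_one) := by
  ext i; fin_cases i <;> rfl

/-- A morphism from the sheaf `F` to the constant sheaf with stalk `M`. -/
structure SheafCocone (F : PosetSheaf k P) (M : Type*) [AddCommGroup M] [Module k M] where
  app : ∀ x, F.obj x →ₗ[k] M
  app_map : ∀ {x y} (h : x ≤ y) (a : F.obj x), app y (F.map h a) = app x a

namespace SheafCocone

variable {F : PosetSheaf k P} {M : Type*} [AddCommGroup M] [Module k M] (l : SheafCocone F M)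

/-- The value in the constant stalk of a cochain at a chain. -/
def value {q : ℕ} (c : Chain P q) : Cochain F q →ₗ[k] M :=
  l.app (c (Fin.last q)) ∘ₗ LinearMap.proj c

theorem value_apply {q : ℕ} (c : Chain P q) (a : Cochain F q) :
    l.value c a = l.app (c (Fin.last q)) (a c) := rfl

theorem value_coboundary_zero (s : Cochain F 0) (c : Chain P 1) :
    l.value c (coboundary F 0 s) = l.value (c.face 0) s - l.value (c.face 1) s := by
  simp only [value_apply, coboundary_zero_apply, map_sub, l.app_map]

theorem value_coboundary_one (a : Cochain F 1) (c : Chain P 2) :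
    l.value c (coboundary F 1 a) =
      l.value (c.face 0) a - l.value (c.face 1) a + l.value (c.face 2) a := by
  rw [value_apply, coboundary_apply, Fin.sum_univ_three]
  simp [value_apply, l.app_map, sub_eq_add_neg]

theorem value_tripleChain_coboundary {x y z : P} (h : x < y) (h' : y < z) (a : Cochain F 1) :
    l.value (tripleChain h h') (coboundary F 1 a) =
      l.value (pairChain h') a - l.value (pairChain (h.trans h')) a + l.value (pairChain h) a := by
  have face_zero : (tripleChain h h').face 0 = pairChain h' := by ext i; fin_cases i <;> rfl
  have face_one : (tripleChain h h').face 1 = pairChain (h.trans h') := by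
    ext i; fin_cases i <;> rfl
  have face_two : (tripleChain h h').face 2 = pairChain h := by ext i; fin_cases i <;> rfl
  rw [value_coboundary_one, face_zero, face_one, face_two]

variable [OrderTop P]

open Classical in
/-- The values of a `1`-cochain on the chains `x < ⊤`: since a constant sheaf on a poset with a
greatest element is acyclic, these determine the image of a `1`-cocycle in the constant sheaf. -/
def potential (x : P) : Cochain F 1 →ₗ[k] M :=
  if h : x < ⊤ then l.value (pairChain h) else 0

theorem potential_of_lt_top {x : P} (h : x < ⊤) : l.potential x = l.value (pairChain h) :=
  dif_pos h

@[simp]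
theorem potential_top : l.potential ⊤ = 0 :=
  dif_neg (lt_irrefl _)

theorem potential_coboundary (x : P) (s : Cochain F 0) :
    l.potential x (coboundary F 0 s) = l.value (pointChain ⊤) s - l.value (pointChain x) s := by
  rcases eq_or_lt_of_le (le_top : x ≤ ⊤) with rfl | h
  · simp
  · have face_zero : (pairChain h).face 0 = pointChain ⊤ := by ext i; fin_cases i; rfl
    have face_one : (pairChain h).face 1 = pointChain x := by ext i; fin_cases i; rfl
    rw [potential_of_lt_top l h, value_coboundary_zero, face_zero, face_one]

theorem value_pairChain_eq_potential_sub {a : Cochain F 1} (ha : coboundary F 1 a = 0) {x y : P}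
    (h : x < y) : l.value (pairChain h) a = l.potential x a - l.potential y a := by
  rcases eq_or_lt_of_le (le_top : y ≤ ⊤) with rfl | hy
  · simp [potential_of_lt_top l h]
  · have cocycle := l.value_tripleChain_coboundary h hy a
    rw [ha, map_zero] at cocycle
    rw [potential_of_lt_top l hy, potential_of_lt_top l (h.trans hy), ← sub_eq_zero, cocycle]
    abel

theorem value_eq_potential_sub {a : Cochain F 1} (ha : coboundary F 1 a = 0) (c : Chain P 1) :
    l.value c a = l.potential (c 0) a - l.potential (c 1) a := by
  conv_lhs => rw [eq_pairChain c]
  exact l.value_pairChain_eq_potential_sub ha _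

theorem mem_range_coboundary_of_potential (hl : ∀ x, Function.Injective (l.app x))
    {a : Cochain F 1} (ha : coboundary F 1 a = 0) (t : M)
    (h : ∀ x, t - l.potential x a ∈ LinearMap.range (l.app x)) :
    a ∈ LinearMap.range (coboundary F 0) := by
  choose s hs using h
  refine ⟨fun c => s _, funext fun c => hl _ ?_⟩
  rw [← value_apply, ← value_apply, value_coboundary_zero, value_apply, value_apply, hs, hs,
    value_eq_potential_sub l ha]
  exact sub_sub_sub_cancel_left _ _ _

theorem exists_cocycle_potential_eq (hl : ∀ x, Function.Injective (l.app x)) {u : P → M}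
    (hu_top : u ⊤ = 0) (hu : ∀ {x y}, x < y → u x - u y ∈ LinearMap.range (l.app y)) :
    ∃ a : Cochain F 1, coboundary F 1 a = 0 ∧ ∀ x, l.potential x a = u x := by
  have mem_range (c : Chain P 1) : u (c 0) - u (c 1) ∈ LinearMap.range (l.app (c 1)) :=
    hu (c.strictMono Fin.zero_lt_one)
  choose a ha using mem_range
  have value_eq (c : Chain P 1) : l.value c a = u (c 0) - u (c 1) := ha c
  refine ⟨a, funext fun c => hl _ ?_, fun x => ?_⟩
  · rw [← value_apply, value_coboundary_one, value_eq, value_eq, value_eq, Pi.zero_apply,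
      LinearMap.map_zero]
    change u (c 1) - u (c 2) - (u (c 0) - u (c 2)) + (u (c 0) - u (c 1)) = 0
    abel
  · rcases eq_or_lt_of_le (le_top : x ≤ ⊤) with rfl | h
    · simp [hu_top]
    · rw [potential_of_lt_top l h, value_eq]
      change u x - u ⊤ = u x
      rw [hu_top, sub_zero]

end SheafCocone

end Cochains

section NormalFan

variable {d : ℕ} {Δ : Set (Fin d → ℝ)}

/-- The face of `Δ` on which the linear form `v` is maximal. -/
def maximizers (Δ : Set (Fin d → ℝ)) (v : Fin d → ℝ) : Set (Fin d → ℝ) :=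
  {u ∈ Δ | ∀ w ∈ Δ, w ⬝ᵥ v ≤ u ⬝ᵥ v}

theorem mem_normalCone_iff_subset_maximizers {A : Set (Fin d → ℝ)} (hA : A ⊆ Δ)
    {v : Fin d → ℝ} : v ∈ normalCone Δ A ↔ A ⊆ maximizers Δ v :=
  ⟨fun h u hu => ⟨hA hu, h u hu⟩, fun h _ hu => (h hu).2⟩

theorem isExposed_maximizers (v : Fin d → ℝ) : IsExposed ℝ Δ (maximizers Δ v) := fun _ =>
  ⟨LinearMap.toContinuousLinearMap ((dotProductBilin ℝ ℝ).flip v), rfl⟩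

theorem maximizers_nonempty (hΔ : IsCompact Δ) (hne : Δ.Nonempty) (v : Fin d → ℝ) :
    (maximizers Δ v).Nonempty :=
  hΔ.exists_isMaxOn hne (f := fun w => w ⬝ᵥ v)
    (continuous_id.dotProduct continuous_const).continuousOn

theorem normalCone_maximizers_mem_normalFan (hΔ : IsCompact Δ) (hne : Δ.Nonempty)
    (v : Fin d → ℝ) : normalCone Δ (maximizers Δ v) ∈ normalFan Δ :=
  ⟨_, maximizers_nonempty hΔ hne v, isExposed_maximizers v, rfl⟩

theorem normalCone_maximizers_le_iff {ρ : PointedCone ℝ (Fin d → ℝ)} (hρ : ρ ∈ normalFan Δ)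
    {v : Fin d → ℝ} : normalCone Δ (maximizers Δ v) ≤ ρ ↔ v ∈ ρ := by
  obtain ⟨A, -, hA, rfl⟩ := hρ
  constructor
  · intro h
    exact h fun _ hu => hu.2
  · intro hv _ hw u hu
    exact hw u ((mem_normalCone_iff_subset_maximizers hA.subset).1 hv hu)

end NormalFan

section CubeFan

variable {d : ℕ} {i j : Fin d}

theorem mem_cube {u : Fin d → ℝ} : u ∈ cube d ↔ ∀ i, |u i| ≤ 1 := by
  simp only [cube, Set.mem_Icc, Pi.le_def, Pi.neg_apply, Pi.one_apply, abs_le, forall_and]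

theorem update_mem_cube {u : Fin d → ℝ} (hu : u ∈ cube d) (i : Fin d) {r : ℝ} (hr : |r| ≤ 1) :
    Function.update u i r ∈ cube d := by
  rw [mem_cube, Function.forall_update_iff u fun _ r => |r| ≤ 1]
  exact ⟨hr, fun j _ => mem_cube.1 hu j⟩

theorem update_dotProduct (u v : Fin d → ℝ) (i : Fin d) (r : ℝ) :
    Function.update u i r ⬝ᵥ v = u ⬝ᵥ v + (r - u i) * v i := by
  have update_eq : Function.update u i r = u + Pi.single i (r - u i) := by
    ext j
    rcases eq_or_ne j i with rfl | hj
    · simp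
    · simp [hj]
  rw [update_eq, add_dotProduct, single_dotProduct]

theorem mem_maximizers_cube {u v : Fin d → ℝ} :
    u ∈ maximizers (cube d) v ↔ u ∈ cube d ∧ ∀ i, |v i| ≤ u i * v i := by
  refine and_congr_right fun hu => ⟨fun h i => ?_, fun h w hw => Finset.sum_le_sum fun i _ => ?_⟩
  · have hsign : |(SignType.sign (v i) : ℝ)| ≤ 1 := by
      rcases lt_trichotomy (v i) 0 with h | h | h <;> simp [h]
    have hmax := h _ (update_mem_cube hu i hsign)
    rw [update_dotProduct, sub_mul, sign_mul_self] at hmax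
    linarith
  · calc w i * v i ≤ |w i| * |v i| := (le_abs_self _).trans (abs_mul _ _).le
      _ ≤ |v i| := mul_le_of_le_one_left (abs_nonneg _) (mem_cube.1 hw i)
      _ ≤ u i * v i := h i

theorem mem_normalCone_cube {A : Set (Fin d → ℝ)} (hA : A ⊆ cube d) {v : Fin d → ℝ} :
    v ∈ normalCone (cube d) A ↔ ∀ u ∈ A, ∀ i, |v i| ≤ u i * v i := by
  rw [mem_normalCone_iff_subset_maximizers hA]
  exact forall₂_congr fun u hu => mem_maximizers_cube.trans (and_iff_right (hA hu))

theorem isCompact_cube : IsCompact (cube d) := isCompact_Icc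

theorem cube_nonempty : (cube d).Nonempty := ⟨0, mem_cube.2 fun i => by simp⟩

/-- The cell of the smallest cone of the fan of the cube that contains `v`. -/
def cell (v : Fin d → ℝ) : CellPoset (cubeFan d) :=
  OrderDual.toDual ⟨_, normalCone_maximizers_mem_normalFan isCompact_cube cube_nonempty v⟩

theorem le_cell_iff {x : CellPoset (cubeFan d)} {v : Fin d → ℝ} : x ≤ cell v ↔ v ∈ x.cone :=
  normalCone_maximizers_le_iff x.ofDual.2

instance : OrderTop (CellPoset (cubeFan d)) where
  top := cell 0
  le_top x := le_cell_iff.2 x.cone.zero_mem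

theorem exists_mem_cone_iff (x : CellPoset (cubeFan d)) :
    ∃ A : Set (Fin d → ℝ), A.Nonempty ∧ ∀ v, v ∈ x.cone ↔ ∀ u ∈ A, ∀ i, |v i| ≤ u i * v i := by
  obtain ⟨A, hne, hA, hx⟩ := x.ofDual.2
  refine ⟨A, hne, fun v => ?_⟩
  rw [CellPoset.cone, hx]
  exact mem_normalCone_cube hA.subset

theorem mem_cone_iff_forall_single {x : CellPoset (cubeFan d)} {v : Fin d → ℝ} :
    v ∈ x.cone ↔ ∀ i, Pi.single i (v i) ∈ x.cone := by
  obtain ⟨A, -, hA⟩ := exists_mem_cone_iff x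
  simp only [hA]
  constructor
  · intro h i u hu j
    rcases eq_or_ne j i with rfl | hj
    · simpa using h u hu j
    · simp [hj]
  · intro h u hu i
    simpa using h i u hu i

theorem apply_eq_zero_of_mem_cone_cell {v w : Fin d → ℝ} (hw : w ∈ (cell v).cone)
    (hi : v i = 0) : w i = 0 := by
  obtain ⟨u, hu⟩ := maximizers_nonempty isCompact_cube cube_nonempty v
  have abs_le {r : ℝ} (hr : |r| = 1) : |w i| ≤ r * w i := by
    have hmax : Function.update u i r ∈ maximizers (cube d) v := by
      rw [mem_maximizers_cube] at hu ⊢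
      refine ⟨update_mem_cube hu.1 i hr.le, fun j => ?_⟩
      rcases eq_or_ne j i with rfl | hj
      · simp [hi]
      · simpa [hj] using hu.2 j
    simpa using (mem_normalCone_cube fun _ h => h.1).1 hw _ hmax i
  have h_pos := abs_le (abs_one (α := ℝ))
  have h_neg := abs_le (r := -1) (by simp)
  exact abs_nonpos_iff.1 (by linarith)

/-- The cell of the ray of the fan of the cube spanned by `± eᵢ`. -/
def ray (i : Fin d) (s : ℤˣ) : CellPoset (cubeFan d) :=
  cell (Pi.single i (s : ℤ))

/-- The cell of the two-dimensional cone of the fan of the cube spanned by `± eᵢ` and `± eⱼ`. -/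
def corner (i j : Fin d) (s t : ℤˣ) : CellPoset (cubeFan d) :=
  cell (Pi.single i ((s : ℤ) : ℝ) + Pi.single j ((t : ℤ) : ℝ))

theorem corner_comm (i j : Fin d) (s t : ℤˣ) : corner i j s t = corner j i t s :=
  congrArg cell (add_comm _ _)

theorem exists_le_ray {x : CellPoset (cubeFan d)} {v : Fin d → ℝ} (hv : v ∈ x.cone)
    (hi : v i ≠ 0) : ∃ s, x ≤ ray i s := by
  have single_mem (s : ℤˣ) (hs : 0 ≤ (s : ℤ) / v i) : x ≤ ray i s := by
    refine le_cell_iff.2 ?_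
    have := x.cone.smul_mem hs (mem_cone_iff_forall_single.1 hv i)
    rwa [← Pi.single_smul, smul_eq_mul, div_mul_cancel₀ _ hi] at this
  rcases hi.lt_or_gt with h | h
  · exact ⟨-1, single_mem _ (div_nonneg_of_nonpos (by simp) h.le)⟩
  · exact ⟨1, single_mem _ (by simpa using h.le)⟩

theorem eq_of_le_ray {x : CellPoset (cubeFan d)} {s t : ℤˣ} (hs : x ≤ ray i s)
    (ht : x ≤ ray i t) : s = t := by
  obtain ⟨A, ⟨u, hu⟩, hA⟩ := exists_mem_cone_iff x
  have hs' := (hA _).1 (le_cell_iff.1 hs) u hu i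
  have ht' := (hA _).1 (le_cell_iff.1 ht) u hu i
  rcases Int.units_eq_one_or s with rfl | rfl <;> rcases Int.units_eq_one_or t with rfl | rfl <;>
    simp at hs' ht' ⊢ <;> linarith

theorem ray_lt_top (i : Fin d) (s : ℤˣ) : ray i s < ⊤ := by
  refine lt_top_iff_ne_top.2 fun h => s.ne_zero ?_
  have hmem : Pi.single i ((s : ℤ) : ℝ) ∈ (⊤ : CellPoset (cubeFan d)).cone := le_cell_iff.1 h.ge
  simpa using apply_eq_zero_of_mem_cone_cell (i := i) hmem rfl

theorem corner_lt_ray (hij : i ≠ j) (s t : ℤˣ) : corner i j s t < ray i s := by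
  have hmem := mem_cone_iff_forall_single.1 (le_cell_iff.1 (le_refl (corner i j s t)))
  refine lt_of_le_of_ne (le_cell_iff.2 (by simpa [hij] using hmem i)) fun h => t.ne_zero ?_
  have hmem_ray : Pi.single j ((t : ℤ) : ℝ) ∈ (ray i s).cone := by
    rw [← h]
    simpa [hij.symm] using hmem j
  simpa using apply_eq_zero_of_mem_cone_cell (i := j) hmem_ray (by simp [hij.symm])

theorem mem_perp_iff {x : CellPoset (cubeFan d)} {m : Fin d → ℤ} :
    m ∈ perp x.cone ↔ ∀ i s, x ≤ ray i s → m i = 0 := by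
  constructor
  · intro hm i s hs
    simpa using hm _ (le_cell_iff.1 hs)
  · intro h v hv
    refine Finset.sum_eq_zero fun i _ => ?_
    by_cases hi : v i = 0
    · simp [hi]
    · obtain ⟨s, hs⟩ := exists_le_ray hv hi
      simp [h i s hs]

theorem single_mem_perp_iff {x : CellPoset (cubeFan d)} :
    Pi.single i 1 ∈ perp x.cone ↔ ∀ s, ¬ x ≤ ray i s := by
  rw [mem_perp_iff]
  constructor
  · intro h s hs
    simpa using h i s hs
  · intro h j s hs
    exact Pi.single_eq_of_ne (by rintro rfl; exact h s hs) _

theorem isCoordinate_perp (x : CellPoset (cubeFan d)) : IsCoordinate (perp x.cone) :=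
  fun _ hm i hi => single_mem_perp_iff.2 fun s hs => hi (mem_perp_iff.1 hm i s hs)

end CubeFan

section Square

variable {d : ℕ} {S : Set (PointedCone ℝ (Fin d → ℝ))}

/-- The pairing of sheaves `∑_{i < j} aᵢ bⱼ eᵢ ∧ eⱼ`, available when every lattice `ρ^⊥` is spanned
by standard basis vectors. -/
def triangularPairing (hS : ∀ x : CellPoset S, IsCoordinate (perp x.cone)) :
    Pairing (multitangentSheaf S 1) (multitangentSheaf S 1) (multitangentSheaf S (1 + 1)) where
  app x := triangularWedge (perp x.cone)
  naturality _ := inclusionMap_triangularWedge (hS _) _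

theorem tropicalCup_self_of_isCoordinate (hS : ∀ x : CellPoset S, IsCoordinate (perp x.cone))
    (β : tropicalCohomology S 1 1) : tropicalCup S β β = 0 :=
  cup_self_of_app_eq_add_swap (μ := wedgePairing S 1 1) (ν := triangularPairing hS)
    (fun x => wedgeModTwo_eq_triangularWedge_add (hS x)) β

end Square

section Cocones

variable {d : ℕ} {S : Set (PointedCone ℝ (Fin d → ℝ))}

/-- The coordinates modulo `2` on the sheaf `𝓕¹ ⊗ 𝔽₂`. -/
def coordCocone (S : Set (PointedCone ℝ (Fin d → ℝ))) :
    SheafCocone (multitangentSheaf S 1) (Fin d → ZMod 2) where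
  app x := coord (perp x.cone)
  app_map _ := coord_inclusionMap _

/-- The coefficient of `eᵢ ∧ eⱼ` modulo `2` on the sheaf `𝓕² ⊗ 𝔽₂`. -/
def minorCocone (S : Set (PointedCone ℝ (Fin d → ℝ))) (i j : Fin d) :
    SheafCocone (multitangentSheaf S (1 + 1)) (ZMod 2) where
  app x := minorModTwo (coordForm (perp x.cone) i) (coordForm (perp x.cone) j)
  app_map _ := minorModTwo_inclusionMap (LinearMap.proj i) (LinearMap.proj j) _

theorem minorCocone_comm (i j : Fin d) : minorCocone S i j = minorCocone S j i := by
  simp only [minorCocone, minorModTwo_comm (coordForm _ i)]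

theorem minorCocone_value_cup (i j : Fin d) {x y z : CellPoset S} (h : x < y) (h' : y < z)
    (a b : Cochain (multitangentSheaf S 1) 1) :
    (minorCocone S i j).value (tripleChain h h') (cochainCup (wedgePairing S 1 1) 1 1 a b) =
      (coordCocone S).value (pairChain h) a i * (coordCocone S).value (pairChain h') b j -
        (coordCocone S).value (pairChain h') b i * (coordCocone S).value (pairChain h) a j := by
  have front_eq : Chain.front (p := 1) (q := 1) (tripleChain h h') = pairChain h := by
    ext i; fin_cases i <;> rfl
  have back_eq : Chain.back (p := 1) (q := 1) (tripleChain h h') = pairChain h' := by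
    ext i; fin_cases i <;> rfl
  have coord_map {c c' : Chain (CellPoset S) 1} (hc : c = c') {w : CellPoset S}
      (hw : c (Fin.last 1) ≤ w) (e : Cochain (multitangentSheaf S 1) 1) (k : Fin d) :
      dualModTwo (coordForm (perp w.cone) k) ((multitangentSheaf S 1).map hw (e c)) =
        (coordCocone S).value c' e k := by
    subst hc
    exact congrFun ((coordCocone S).app_map hw (e c)) k
  rw [SheafCocone.value_apply, cochainCup_apply]
  refine (minorModTwo_wedge _ _ _ _).trans ?_
  simp only [coord_map front_eq, coord_map back_eq]

end Cocones

section FirstCohomology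

variable {d : ℕ} {i : Fin d} {s : ℤˣ}

theorem coordForm_eq_zero_of_le_ray {x : CellPoset (cubeFan d)} (h : x ≤ ray i s) :
    coordForm (perp x.cone) i = 0 :=
  coordForm_eq_zero (isCoordinate_perp x) fun hi => single_mem_perp_iff.1 hi s h

theorem coord_value_eq_zero {q : ℕ} {c : Chain (CellPoset (cubeFan d)) q}
    (h : c (Fin.last q) ≤ ray i s) (a : Cochain (multitangentSheaf (cubeFan d) 1) q) :
    (coordCocone (cubeFan d)).value c a i = 0 :=
  coord_eq_zero (isCoordinate_perp _) (fun hi => single_mem_perp_iff.1 hi s h) _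

theorem mem_range_coordCocone_app {x : CellPoset (cubeFan d)} {t : Fin d → ZMod 2} :
    t ∈ LinearMap.range ((coordCocone (cubeFan d)).app x) ↔ ∀ i s, x ≤ ray i s → t i = 0 := by
  refine (mem_range_coord (isCoordinate_perp x)).trans (forall_congr' fun i => ?_)
  rw [single_mem_perp_iff, not_forall_not, forall_exists_index]

theorem coordCocone_app_injective (x : CellPoset (cubeFan d)) :
    Function.Injective ((coordCocone (cubeFan d)).app x) :=
  coord_injective (isCoordinate_perp x)

theorem potential_apply_of_le_ray {a : Cochain (multitangentSheaf (cubeFan d) 1) 1}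
    (ha : coboundary _ 1 a = 0) {x : CellPoset (cubeFan d)} (hx : x ≤ ray i s) :
    (coordCocone (cubeFan d)).potential x a i =
      (coordCocone (cubeFan d)).potential (ray i s) a i := by
  rcases hx.eq_or_lt with rfl | hx
  · rfl
  · have value_eq := congrFun ((coordCocone _).value_pairChain_eq_potential_sub ha hx) i
    rw [coord_value_eq_zero (s := s) (le_refl _)] at value_eq
    exact sub_eq_zero.1 value_eq.symm

/-- The `i`-th period of a `1`-cochain: the sum of the `i`-th coordinates of its potentials at the
two rays `± eᵢ`. -/
def period : Cochain (multitangentSheaf (cubeFan d) 1) 1 →ₗ[ZMod 2] (Fin d → ZMod 2) :=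
  LinearMap.pi fun i => ∑ s, LinearMap.proj i ∘ₗ (coordCocone (cubeFan d)).potential (ray i s)

theorem period_apply (a : Cochain (multitangentSheaf (cubeFan d) 1) 1) (i : Fin d) :
    period a i = ∑ s, (coordCocone (cubeFan d)).potential (ray i s) a i := by
  simp [period]

theorem sum_units_const (r : ZMod 2) : ∑ _s : ℤˣ, r = 0 :=
  (Finset.sum_const r).trans (ZModModule.char_nsmul_eq_zero 2 r)

theorem period_coboundary (f : Cochain (multitangentSheaf (cubeFan d) 1) 0) :
    period (coboundary _ 0 f) = 0 := by
  ext i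
  have potential_eq (s : ℤˣ) :
      (coordCocone (cubeFan d)).potential (ray i s) (coboundary _ 0 f) i =
        (coordCocone (cubeFan d)).value (pointChain ⊤) f i := by
    rw [SheafCocone.potential_coboundary, Pi.sub_apply,
      coord_value_eq_zero (c := pointChain (ray i s)) (le_refl (ray i s)), sub_zero]
  simp only [period_apply, potential_eq, sum_units_const, Pi.zero_apply]

theorem mem_range_coboundary_of_period_eq_zero
    {a : Cochain (multitangentSheaf (cubeFan d) 1) 1} (ha : coboundary _ 1 a = 0)
    (hp : period a = 0) : a ∈ LinearMap.range (coboundary _ 0) := by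
  have potential_ray_eq (i : Fin d) (s : ℤˣ) :
      (coordCocone (cubeFan d)).potential (ray i s) a i =
        (coordCocone (cubeFan d)).potential (ray i 1) a i := by
    have hp_i := congrFun hp i
    rw [period_apply, UnitsInt.univ, Finset.sum_pair (by decide)] at hp_i
    rcases Int.units_eq_one_or s with rfl | rfl
    · rfl
    · exact (CharTwo.add_eq_zero.1 hp_i).symm
  refine (coordCocone _).mem_range_coboundary_of_potential coordCocone_app_injective ha
    (fun i => (coordCocone (cubeFan d)).potential (ray i 1) a i) fun x => ?_
  refine mem_range_coordCocone_app.2 fun i s hx => ?_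
  rw [Pi.sub_apply, potential_apply_of_le_ray ha hx, potential_ray_eq i s, sub_self]

open Classical in
theorem exists_cocycle_period_eq (v : Fin d → ZMod 2) :
    ∃ a : Cochain (multitangentSheaf (cubeFan d) 1) 1, coboundary _ 1 a = 0 ∧ period a = v := by
  let u (x : CellPoset (cubeFan d)) (i : Fin d) : ZMod 2 := if x ≤ ray i 1 then v i else 0
  have u_apply {x : CellPoset (cubeFan d)} {i : Fin d} {s : ℤˣ} (hx : x ≤ ray i s) :
      u x i = if s = 1 then v i else 0 :=
    if_congr ⟨fun h => eq_of_le_ray hx h, fun h => h ▸ hx⟩ rfl rfl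
  obtain ⟨a, ha, potential_eq⟩ := (coordCocone (cubeFan d)).exists_cocycle_potential_eq (u := u)
    coordCocone_app_injective (funext fun i => if_neg (ray_lt_top i 1).not_ge) fun hxy =>
      mem_range_coordCocone_app.2 fun i s hy => by
        rw [Pi.sub_apply, u_apply hy, u_apply (hxy.le.trans hy), sub_self]
  refine ⟨a, ha, funext fun i => ?_⟩
  simp [period_apply, potential_eq, u_apply (le_refl (ray i _))]

/-- The periods of a class in `H¹(𝕋Σ_□, 𝓕¹ ⊗ 𝔽₂)`. -/
def cohomologyPeriod (d : ℕ) : tropicalCohomology (cubeFan d) 1 1 →ₗ[ZMod 2] (Fin d → ZMod 2) :=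
  cohomologyLift period period_coboundary

theorem cohomologyPeriod_bijective (d : ℕ) : Function.Bijective (cohomologyPeriod d) := by
  constructor
  · rw [← LinearMap.ker_eq_bot, LinearMap.ker_eq_bot']
    intro β hβ
    obtain ⟨a, rfl⟩ := Submodule.Quotient.mk_surjective _ β
    exact (Submodule.Quotient.mk_eq_zero _).2 (mem_range_coboundary_of_period_eq_zero a.2 hβ)
  · intro v
    obtain ⟨a, ha, rfl⟩ := exists_cocycle_period_eq v
    exact ⟨Submodule.Quotient.mk ⟨a, ha⟩, rfl⟩

/-- The isomorphism `H¹(𝕋Σ_□, 𝓕¹ ⊗ 𝔽₂) ≅ 𝔽₂^d` given by the periods. -/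
def periodEquiv (d : ℕ) : tropicalCohomology (cubeFan d) 1 1 ≃ₗ[ZMod 2] (Fin d → ZMod 2) :=
  LinearEquiv.ofBijective (cohomologyPeriod d) (cohomologyPeriod_bijective d)

end FirstCohomology

section PlanePeriod

variable {d : ℕ} {i j : Fin d}

theorem minor_value_eq_zero {c : Chain (CellPoset (cubeFan d)) 1} {s : ℤˣ}
    (h : c (Fin.last 1) ≤ ray i s) (w : Cochain (multitangentSheaf (cubeFan d) (1 + 1)) 1) :
    (minorCocone (cubeFan d) i j).value c w = 0 := by
  rw [SheafCocone.value_apply, minorCocone]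
  simp only [coordForm_eq_zero_of_le_ray h, minorModTwo_zero_left]
  rfl

/-- The sum of the `eᵢ ∧ eⱼ`-coefficients of a `2`-cochain over the flags
`corner i j s t < ray i s < ⊤`. -/
def flagSum (hij : i ≠ j) : Cochain (multitangentSheaf (cubeFan d) (1 + 1)) 2 →ₗ[ZMod 2] ZMod 2 :=
  ∑ s, ∑ t, (minorCocone (cubeFan d) i j).value
    (tripleChain (corner_lt_ray hij s t) (ray_lt_top i s))

theorem flagSum_apply (hij : i ≠ j) (c : Cochain (multitangentSheaf (cubeFan d) (1 + 1)) 2) :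
    flagSum hij c = ∑ s, ∑ t, (minorCocone (cubeFan d) i j).value
      (tripleChain (corner_lt_ray hij s t) (ray_lt_top i s)) c := by
  simp [flagSum]

theorem flagSum_coboundary (hij : i ≠ j)
    (w : Cochain (multitangentSheaf (cubeFan d) (1 + 1)) 1) :
    flagSum hij (coboundary _ 1 w) =
      ∑ s, ∑ t, (minorCocone (cubeFan d) i j).potential (corner i j s t) w := by
  have flag_eq (s t : ℤˣ) :
      (minorCocone (cubeFan d) i j).value
          (tripleChain (corner_lt_ray hij s t) (ray_lt_top i s)) (coboundary _ 1 w) =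
        (minorCocone (cubeFan d) i j).potential (ray i s) w +
          (minorCocone (cubeFan d) i j).potential (corner i j s t) w := by
    rw [SheafCocone.value_tripleChain_coboundary,
      minor_value_eq_zero (c := pairChain (corner_lt_ray hij s t)) (le_refl (ray i s)), add_zero,
      CharTwo.sub_eq_add, SheafCocone.potential_of_lt_top _ (ray_lt_top i s),
      SheafCocone.potential_of_lt_top _ ((corner_lt_ray hij s t).trans (ray_lt_top i s))]
  simp only [flagSum_apply, flag_eq, Finset.sum_add_distrib, sum_units_const,
    zero_add]

theorem flagSum_add_flagSum_symm_coboundary (hij : i ≠ j)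
    (w : Cochain (multitangentSheaf (cubeFan d) (1 + 1)) 1) :
    (flagSum hij + flagSum hij.symm) (coboundary _ 1 w) = 0 := by
  rw [LinearMap.add_apply, flagSum_coboundary, flagSum_coboundary, Finset.sum_comm,
    minorCocone_comm]
  simp only [corner_comm j i]
  exact CharTwo.add_self_eq_zero _

theorem flagSum_cup (hij : i ≠ j) {a : Cochain (multitangentSheaf (cubeFan d) 1) 1}
    (ha : coboundary _ 1 a = 0) (b : Cochain (multitangentSheaf (cubeFan d) 1) 1) :
    flagSum hij (cochainCup (wedgePairing (cubeFan d) 1 1) 1 1 a b) =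
      period a j * period b i := by
  let p (k l : Fin d) (s : ℤˣ) (e : Cochain (multitangentSheaf (cubeFan d) 1) 1) : ZMod 2 :=
    (coordCocone (cubeFan d)).potential (ray k s) e l
  have flag_eq (s t : ℤˣ) :
      (minorCocone (cubeFan d) i j).value
          (tripleChain (corner_lt_ray hij s t) (ray_lt_top i s))
          (cochainCup (wedgePairing (cubeFan d) 1 1) 1 1 a b) =
        p i i s b * (p j j t a + p i j s a) := by
    have le_ray : corner i j s t ≤ ray j t :=
      corner_comm i j s t ▸ (corner_lt_ray hij.symm t s).le
    rw [minorCocone_value_cup,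
      coord_value_eq_zero (c := pairChain (corner_lt_ray hij s t)) (le_refl (ray i s)), zero_mul,
      CharTwo.sub_eq_add, zero_add, SheafCocone.value_pairChain_eq_potential_sub _ ha,
      Pi.sub_apply, potential_apply_of_le_ray ha le_ray, CharTwo.sub_eq_add,
      ← SheafCocone.potential_of_lt_top _ (ray_lt_top i s)]
  simp only [flagSum_apply, flag_eq, ← Finset.mul_sum, Finset.sum_add_distrib, sum_units_const,
    add_zero, ← Finset.sum_mul, period_apply, p]
  exact mul_comm _ _

theorem flagSum_add_flagSum_symm_cup (hij : i ≠ j)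
    {a : Cochain (multitangentSheaf (cubeFan d) 1) 1} (ha : coboundary _ 1 a = 0)
    (b : Cochain (multitangentSheaf (cubeFan d) 1) 1) :
    (flagSum hij + flagSum hij.symm) (cochainCup (wedgePairing (cubeFan d) 1 1) 1 1 a b) =
      period a i * period b j - period a j * period b i := by
  rw [LinearMap.add_apply, flagSum_cup hij ha, flagSum_cup hij.symm ha, CharTwo.sub_eq_add,
    add_comm]

/-- The period along the `ij`-plane of a class in `H²(𝕋Σ_□, 𝓕² ⊗ 𝔽₂)`. -/
def planePeriod (hij : i ≠ j) : tropicalCohomology (cubeFan d) 2 (1 + 1) →ₗ[ZMod 2] ZMod 2 :=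
  cohomologyLift (flagSum hij + flagSum hij.symm) (flagSum_add_flagSum_symm_coboundary hij)

theorem planePeriod_tropicalCup_mk (hij : i ≠ j)
    (a b : cocycles (multitangentSheaf (cubeFan d) 1) 1) :
    planePeriod hij (tropicalCup (cubeFan d) (Submodule.Quotient.mk a) (Submodule.Quotient.mk b)) =
      period a.1 i * period b.1 j - period a.1 j * period b.1 i :=
  flagSum_add_flagSum_symm_cup hij a.2 b.1

theorem planePeriod_tropicalCup (hij : i ≠ j) (β D : tropicalCohomology (cubeFan d) 1 1) :
    planePeriod hij (tropicalCup (cubeFan d) β D) =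
      periodEquiv d β i * periodEquiv d D j - periodEquiv d β j * periodEquiv d D i := by
  induction β using Submodule.Quotient.induction_on with | _ a
  induction D using Submodule.Quotient.induction_on with | _ b
  exact planePeriod_tropicalCup_mk hij a b

end PlanePeriod

section LinearAlgebra

theorem mem_span_singleton_of_mul_eq_mul {ι K : Type*} [Field K] {f g : ι → K} (hg : g ≠ 0)
    (h : ∀ i j, f i * g j = f j * g i) : f ∈ Submodule.span K {g} := by
  obtain ⟨j, hj⟩ := Function.ne_iff.1 hg
  refine Submodule.mem_span_singleton.2 ⟨f j / g j, funext fun i => ?_⟩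
  rw [Pi.smul_apply, smul_eq_mul, div_mul_eq_mul_div, div_eq_iff hj, h]

theorem rank_eq_of_ker_eq_span_singleton {K V W : Type*} [Field K] [AddCommGroup V] [Module K V]
    [AddCommGroup W] [Module K W] {n : ℕ} (hV : Module.finrank K V = n + 1) {g : V →ₗ[K] W}
    {v : V} (hv : v ≠ 0) (hg : LinearMap.ker g = Submodule.span K {v}) :
    LinearMap.rank g = (n : Cardinal) := by
  have : Module.Finite K V := Module.finite_of_finrank_eq_succ hV
  have rank_nullity := LinearMap.finrank_range_add_finrank_ker g
  rw [hg, finrank_span_singleton hv, hV, Nat.add_right_cancel_iff] at rank_nullity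
  rw [LinearMap.rank, ← Module.finrank_eq_rank, rank_nullity]

end LinearAlgebra

section CubeCohomology

variable {d : ℕ}

theorem tropicalCup_self (β : tropicalCohomology (cubeFan d) 1 1) :
    tropicalCup (cubeFan d) β β = 0 :=
  tropicalCup_self_of_isCoordinate isCoordinate_perp β

theorem finrank_tropicalCohomology_one_one (d : ℕ) :
    Module.finrank (ZMod 2) (tropicalCohomology (cubeFan d) 1 1) = d :=
  (periodEquiv d).finrank_eq.trans (Module.finrank_fin_fun _)

theorem mem_span_of_tropicalCup_eq_zero {β D : tropicalCohomology (cubeFan d) 1 1} (hD : D ≠ 0)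
    (h : tropicalCup (cubeFan d) β D = 0) : β ∈ Submodule.span (ZMod 2) {D} := by
  have proportional (i j : Fin d) :
      periodEquiv d β i * periodEquiv d D j = periodEquiv d β j * periodEquiv d D i := by
    rcases eq_or_ne i j with rfl | hij
    · rfl
    · rw [← sub_eq_zero, ← planePeriod_tropicalCup hij, h, map_zero]
  have mem_span := mem_span_singleton_of_mul_eq_mul
    ((periodEquiv d).map_ne_zero_iff.2 hD) proportional
  obtain ⟨r, hr⟩ := Submodule.mem_span_singleton.1 mem_span
  exact Submodule.mem_span_singleton.2 ⟨r, (periodEquiv d).injective (by rw [map_smul, hr])⟩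

theorem ker_tropicalCup_flip {D : tropicalCohomology (cubeFan d) 1 1} (hD : D ≠ 0) :
    LinearMap.ker ((tropicalCup (cubeFan d)).flip D) = Submodule.span (ZMod 2) {D} :=
  le_antisymm (fun _ hβ => mem_span_of_tropicalCup_eq_zero hD hβ)
    ((Submodule.span_singleton_le_iff_mem _ _).2 (tropicalCup_self D))

end CubeCohomology

end TropicalCube

end

theorem mainTheorem11 (n : ℕ) :
    (∀ β : TropicalCube.tropicalCohomology (TropicalCube.cubeFan (n + 1)) 1 1,
      TropicalCube.tropicalCup (TropicalCube.cubeFan (n + 1)) β β = 0) ∧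
    ∀ D : TropicalCube.tropicalCohomology (TropicalCube.cubeFan (n + 1)) 1 1, D ≠ 0 →
      LinearMap.ker ((TropicalCube.tropicalCup (TropicalCube.cubeFan (n + 1))).flip D) =
          Submodule.span (ZMod 2) {D} ∧
        LinearMap.rank ((TropicalCube.tropicalCup (TropicalCube.cubeFan (n + 1))).flip D) =
          (n : Cardinal) :=
  ⟨TropicalCube.tropicalCup_self, fun _ hD =>
    have ker_eq := TropicalCube.ker_tropicalCup_flip hD
    ⟨ker_eq, TropicalCube.rank_eq_of_ker_eq_span_singleton
      (TropicalCube.finrank_tropicalCohomology_one_one (n + 1)) hD ker_eq⟩⟩
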